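/- **Setting.** Let $\Omega\subset\mathbb R^n$ be a bounded Lipschitz domain and $\mathcal T_h$ a finite partition of $\Omega$ into non-overlapping Lipschitz subdomains $K$. Let $\mathrm D=\mathrm d+\delta$ be the Hodge--Dirac operator on differential forms of all degrees, with $\mathrm d,\delta$ in the sense of distributions, $H\Lambda(K)=\{w\in L^2\Lambda(K):\mathrm dw\in L^2\Lambda(K)\}$ and $H^*\Lambda(K)=\{w\in L^2\Lambda(K):\delta w\in L^2\Lambda(K)\}$. Let $W_h=\prod_K W_h(K)$ with $W_h(K)\subset H\Lambda(K)\cap H^*\Lambda(K)$ such that the weak tangential and normal traces $w^{\rm tan},w^{\rm nor}$ of each $w\in W_h(K)$ lie in $L^2\Lambda(\partial K)$. Let $\widehat W_h^{\rm nor}=\prod_K\widehat W_h^{\rm nor}(\partial K)$ and $\widehat W_h^{\rm tan}=\prod_K\widehat W_h^{\rm tan}(\partial K)$ with $\widehat W_h^{\rm nor}(\partial K),\widehat W_h^{\rm tan}(\partial K)\subset L^2\Lambda(\partial K)$, and let $\mathring V_h^{\rm tan}\subset\widehat W_h^{\rm tan}$ be the subspace of traces that are single-valued on interior interfaces and vanish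 on $\partial\Omega$. Write $(\cdot,\cdot)=\sum_K(\cdot,\cdot)_{L^2\Lambda(K)}$, $\langle\cdot,\cdot\rangle=\sum_K\langle\cdot,\cdot\rangle_{L^2\Lambda(\partial K)}$ and $[\widehat z,w]=\langle\widehat z^{\rm tan},w^{\rm nor}\rangle-\langle w^{\rm tan},\widehat z^{\rm nor}\rangle$. Bold symbols denote tensor products with $\mathbb R^2$: $\mathbf z=(q,p)$, $\mathbf J(q,p)=(-p,q)$, $\mathbf D(q,p)=(\mathrm Dq,\mathrm Dp)$, and inner products and brackets are summed over the two components. Let $I\subset\mathbb R$ be a time interval, $\mathbf f=(f_q,f_p)=\prod_K\mathbf f_K$ with $\mathbf f_K:I\times\mathbf W_h(K)\to\mathbf L^2\mathbf\Lambda(K)$, and let $\mathbf\Phi=\prod_K\mathbf\Phi_K$ with $\mathbf\Phi_K:\mathbf W_h(K)\times\widehat{\mathbf W}_h^{\rm nor}(\partial K)\times\widehat{\mathbf W}_h^{\rm tan}(\partial K)\to\mathbf L^2\mathbf\Lambda(\partial K)$ linear. For $t\in I$ consider the equations $$(\mathbf J\dot{\mathbf z},\mathbf w)+(\mathbf z,\mathbf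 D\mathbf w)+[\widehat{\mathbf z},\mathbf w]=(\mathbf f(t,\mathbf z),\mathbf w),\tag{1}$$ $$\langle\mathbf\Phi(\mathbf z,\widehat{\mathbf z}),\widehat{\mathbf w}^{\rm nor}\rangle=0\ \ \forall\widehat{\mathbf w}^{\rm nor}\in\widehat{\mathbf W}_h^{\rm nor},\qquad\langle\widehat{\mathbf z}^{\rm nor},\widehat{\mathbf w}^{\rm tan}\rangle=0\ \ \forall\widehat{\mathbf w}^{\rm tan}\in\mathring{\mathbf V}_h^{\rm tan}.\tag{2}$$ **Assumption.** $\widetilde W_h$ is a finite-dimensional real inner product space, $\widetilde{\mathbf W}_h=\widetilde W_h\otimes\mathbb R^2$, $\widetilde{\mathbf J}(\widetilde q,\widetilde p)=(-\widetilde p,\widetilde q)$, and $\mathbf\Theta:I\times\widetilde{\mathbf W}_h\to\mathbf W_h\times\widehat{\mathbf W}_h^{\rm nor}\times\mathring{\mathbf V}_h^{\rm tan}$, $(t,\widetilde{\mathbf z})\mapsto(\mathbf z,\widehat{\mathbf z})$, is such that for all $t\in I$: (a) the map $\widetilde{\mathbf z}\mapsto\mathbf z$ is differentiable, independent of $t$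 and symplectic, i.e. $(\mathbf J\mathbf w_1,\mathbf w_2)=(\widetilde{\mathbf J}\widetilde{\mathbf w}_1,\widetilde{\mathbf w}_2)$ whenever $\mathbf w_i=\frac{\partial\mathbf z}{\partial\widetilde{\mathbf z}}\widetilde{\mathbf w}_i$; (b) if $\dot{\widetilde{\mathbf z}}\in\widetilde{\mathbf W}_h$ is such that (1) holds with $\dot{\mathbf z}=\frac{\partial\mathbf z}{\partial\widetilde{\mathbf z}}\dot{\widetilde{\mathbf z}}$ for all $\mathbf w=\frac{\partial\mathbf z}{\partial\widetilde{\mathbf z}}\widetilde{\mathbf w}$, $\widetilde{\mathbf w}\in\widetilde{\mathbf W}_h$, then (1) holds for all $\mathbf w\in\mathbf W_h$; (c) (2) holds for $(\mathbf z,\widehat{\mathbf z})=\mathbf\Theta(t,\widetilde{\mathbf z})$, for all $\widetilde{\mathbf z}\in\widetilde{\mathbf W}_h$. Define $\widetilde{\mathbf f}:I\times\widetilde{\mathbf W}_h\to\widetilde{\mathbf W}_h$ by $(\widetilde{\mathbf f}(t,\widetilde{\mathbf z}),\widetilde{\mathbf w})=(\mathbf f(t,\mathbf z),\mathbf w)-(\mathbf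 z,\mathbf D\mathbf w)-[\widehat{\mathbf z},\mathbf w]$ for all $\widetilde{\mathbf w}$, where $(\mathbf z,\widehat{\mathbf z})=\mathbf\Theta(t,\widetilde{\mathbf z})$ and $\mathbf w=\frac{\partial\mathbf z}{\partial\widetilde{\mathbf z}}\widetilde{\mathbf w}$; the reduced ODE is $\widetilde{\mathbf J}\dot{\widetilde{\mathbf z}}=\widetilde{\mathbf f}(t,\widetilde{\mathbf z})$. Below, $t^0,\Delta t\in\mathbb R$, $a_{ij},b_i,c_i,\bar a_{ij},\bar b_i,\bar c_i$ $(1\le i,j\le s)$ are arbitrary real coefficients, $T^i=t^0+c_i\Delta t\in I$, $\bar T^i=t^0+\bar c_i\Delta t\in I$ (the latter only in part 2), and $\mathbf z^0=(q^0,p^0)$, $\mathbf z^1=(q^1,p^1)$ are the images of $\widetilde{\mathbf z}^0,\widetilde{\mathbf z}^1$ under $\widetilde{\mathbf z}\mapsto\mathbf z$. **Theorem.** Suppose the Assumption holds. 1. (Runge--Kutta.) Suppose that $\widetilde{\mathbf z}\mapsto\mathbf z$ is linear, and let $(\mathbf Z^i,\widehat{\mathbf Z}^i)=\mathbf\Theta(T^i,\widetilde{\mathbf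 Z}^i)$. Then the stage equations $$\widetilde{\mathbf J}\widetilde{\mathbf Z}^i=\widetilde{\mathbf J}\widetilde{\mathbf z}^0+\Delta t\sum_j a_{ij}\widetilde{\mathbf f}(T^j,\widetilde{\mathbf Z}^j),\qquad i=1,\dots,s,$$ hold if and only if, for every $i$, $$(\mathbf J\mathbf Z^i,\mathbf w)+\Delta t\sum_j a_{ij}\bigl((\mathbf Z^j,\mathbf D\mathbf w)+[\widehat{\mathbf Z}^j,\mathbf w]\bigr)=(\mathbf J\mathbf z^0,\mathbf w)+\Delta t\sum_j a_{ij}(\mathbf f(T^j,\mathbf Z^j),\mathbf w),$$ $$\langle\mathbf\Phi(\mathbf Z^i,\widehat{\mathbf Z}^i),\widehat{\mathbf w}^{\rm nor}\rangle=0,\qquad\langle\widehat{\mathbf Z}^{i,\rm nor},\widehat{\mathbf w}^{\rm tan}\rangle=0$$ for all $\mathbf w\in\mathbf W_h$, $\widehat{\mathbf w}^{\rm nor}\in\widehat{\mathbf W}_h^{\rm nor}$, $\widehat{\mathbf w}^{\rm tan}\in\mathring{\mathbf V}_h^{\rm tan}$. Moreover the step equation $\widetilde{\mathbf J}\widetilde{\mathbf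 z}^1=\widetilde{\mathbf J}\widetilde{\mathbf z}^0+\Delta t\sum_i b_i\widetilde{\mathbf f}(T^i,\widetilde{\mathbf Z}^i)$ holds if and only if, for all $\mathbf w\in\mathbf W_h$, $$(\mathbf J\mathbf z^1,\mathbf w)+\Delta t\sum_i b_i\bigl((\mathbf Z^i,\mathbf D\mathbf w)+[\widehat{\mathbf Z}^i,\mathbf w]\bigr)=(\mathbf J\mathbf z^0,\mathbf w)+\Delta t\sum_i b_i(\mathbf f(T^i,\mathbf Z^i),\mathbf w).$$ 2. (Partitioned Runge--Kutta.) Suppose that $\widetilde{\mathbf z}\mapsto\mathbf z$ partitions into linear maps $\widetilde q\mapsto q$ and $\widetilde p\mapsto p$, and that $\mathbf\Phi(\mathbf z,\widehat{\mathbf z})=(\Phi_q(q,\widehat q),\Phi_p(p,\widehat p))$. Write $\mathbf\Theta=(\Theta_q,\Theta_p)$ with $\Theta_q:(t,\widetilde q,\widetilde p)\mapsto(q,\widehat q)$ and $\Theta_p:(t,\widetilde q,\widetilde p)\mapsto(p,\widehat p)$, and define $\widetilde f_p,\widetilde f_q$ by $$(\widetilde f_p(t,\widetilde q,\widetilde p),\widetilde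 r)=(f_p(t,q,p),r)-(p,\mathrm Dr)-[\widehat p,r],\qquad(\widetilde f_q(t,\widetilde q,\widetilde p),\widetilde u)=(f_q(t,q,p),u)-(q,\mathrm Du)-[\widehat q,u]$$ for all $\widetilde r,\widetilde u\in\widetilde W_h$, where $(q,\widehat q)=\Theta_q(t,\widetilde q,\widetilde p)$, $(p,\widehat p)=\Theta_p(t,\widetilde q,\widetilde p)$, $r$ is the image of $\widetilde r$ under $\widetilde p\mapsto p$, and $u$ is the image of $\widetilde u$ under $\widetilde q\mapsto q$. Let $(Q^i,\widehat Q^i)=\Theta_q(\bar T^i,\widetilde Q^i,\widetilde P^i)$ and $(P^i,\widehat P^i)=\Theta_p(T^i,\widetilde Q^i,\widetilde P^i)$. Then the stage equations $$\widetilde Q^i=\widetilde q^0+\Delta t\sum_j a_{ij}\widetilde f_p(T^j,\widetilde Q^j,\widetilde P^j),\qquad\widetilde P^i=\widetilde p^0-\Delta t\sum_j\bar a_{ij}\widetilde f_q(\bar T^j,\widetilde Q^j,\widetilde P^j),\qquad i=1,\dots,s,$$ hold if and only if, for every $i$, $$(Q^i,r)+\Delta t\sum_j a_{ij}\bigl((P^j,\mathrm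 Dr)+[\widehat P^j,r]\bigr)=(q^0,r)+\Delta t\sum_j a_{ij}(f_p(T^j,Q^j,P^j),r),$$ $$-(P^i,u)+\Delta t\sum_j\bar a_{ij}\bigl((Q^j,\mathrm Du)+[\widehat Q^j,u]\bigr)=-(p^0,u)+\Delta t\sum_j\bar a_{ij}(f_q(\bar T^j,Q^j,P^j),u),$$ $$\langle\Phi_q(Q^i,\widehat Q^i),\widehat u^{\rm nor}\rangle=\langle\Phi_p(P^i,\widehat P^i),\widehat r^{\rm nor}\rangle=0,\qquad\langle\widehat Q^{i,\rm nor},\widehat u^{\rm tan}\rangle=\langle\widehat P^{i,\rm nor},\widehat r^{\rm tan}\rangle=0$$ for all $r,u\in W_h$, $\widehat r^{\rm nor},\widehat u^{\rm nor}\in\widehat W_h^{\rm nor}$, $\widehat r^{\rm tan},\widehat u^{\rm tan}\in\mathring V_h^{\rm tan}$. Moreover the step equations $\widetilde q^1=\widetilde q^0+\Delta t\sum_i b_i\widetilde f_p(T^i,\widetilde Q^i,\widetilde P^i)$ and $\widetilde p^1=\widetilde p^0-\Delta t\sum_i\bar b_i\widetilde f_q(\bar T^i,\widetilde Q^i,\widetilde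 P^i)$ both hold if and only if, for all $r,u\in W_h$, $$(q^1,r)+\Delta t\sum_i b_i\bigl((P^i,\mathrm Dr)+[\widehat P^i,r]\bigr)=(q^0,r)+\Delta t\sum_i b_i(f_p(T^i,Q^i,P^i),r),$$ $$-(p^1,u)+\Delta t\sum_i\bar b_i\bigl((Q^i,\mathrm Du)+[\widehat Q^i,u]\bigr)=-(p^0,u)+\Delta t\sum_i\bar b_i(f_q(\bar T^i,Q^i,P^i),u).$$ -/

import Mathlib

open MeasureTheory Set
open scoped ContDiff

namespace HybridFEEC

noncomputable section

/-! ### Exterior algebra of Euclidean space -/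

/-- Euclidean space `ℝⁿ`. -/
abbrev Euc (n : ℕ) := EuclideanSpace ℝ (Fin n)

/-- The exterior algebra `Alt ℝⁿ = ⨁ₖ Altᵏ ℝⁿ` with its Euclidean inner product.  A form is given by
its coefficients in the orthonormal basis `dx^S = dx^{i₁} ∧ ⋯ ∧ dx^{iₖ}`,
`S = {i₁ < ⋯ < iₖ}`; the degree of `dx^S` is the cardinality of `S`. -/
abbrev Alt (n : ℕ) := EuclideanSpace ℝ (Finset (Fin n))

/-- The sign `(-1)^#{j ∈ S : j < i}`, so that
`dx^i ∧ dx^(S \ {i}) = altSign i S • dx^S` for `i ∈ S`. -/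
def altSign {n : ℕ} (i : Fin n) (S : Finset (Fin n)) : ℝ :=
  (-1) ^ (S.filter (fun j => j < i)).card

/-- The wedge product `a♭ ∧ w` of the covector dual to `a` with the form `w`. -/
def wedge {n : ℕ} : Euc n →ₗ[ℝ] Alt n →ₗ[ℝ] Alt n :=
  LinearMap.mk₂ ℝ
    (fun a w => WithLp.toLp 2 fun S => ∑ i ∈ S, altSign i S * a i * w (S.erase i))
    (fun a b w => by ext S; simp [mul_add, add_mul, Finset.sum_add_distrib])
    (fun c a w => by
      ext S; simp only [PiLp.smul_apply, smul_eq_mul, Finset.mul_sum]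
      exact Finset.sum_congr rfl fun i _ => by ring)
    (fun a v w => by ext S; simp [mul_add, Finset.sum_add_distrib])
    (fun c a w => by
      ext S; simp only [PiLp.smul_apply, smul_eq_mul, Finset.mul_sum]
      exact Finset.sum_congr rfl fun i _ => by ring)

/-- The contraction (interior product) `ι_a w`, which is the adjoint of `w ↦ a♭ ∧ w`. -/
def contract {n : ℕ} : Euc n →ₗ[ℝ] Alt n →ₗ[ℝ] Alt n :=
  LinearMap.mk₂ ℝ
    (fun a w => WithLp.toLp 2 fun S => ∑ i ∈ Sᶜ, altSign i S * a i * w (insert i S))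
    (fun a b w => by ext S; simp [mul_add, add_mul, Finset.sum_add_distrib])
    (fun c a w => by
      ext S; simp only [PiLp.smul_apply, smul_eq_mul, Finset.mul_sum]
      exact Finset.sum_congr rfl fun i _ => by ring)
    (fun a v w => by ext S; simp [mul_add, Finset.sum_add_distrib])
    (fun c a w => by
      ext S; simp only [PiLp.smul_apply, smul_eq_mul, Finset.mul_sum]
      exact Finset.sum_congr rfl fun i _ => by ring)

/-! ### Smooth forms, exterior differential and codifferential -/

/-- The `i`-th standard basis vector. -/
def stdVec {n : ℕ} (i : Fin n) : Euc n := EuclideanSpace.single i 1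

/-- `∑ᵢ dx^i ∧ (A eᵢ)`, so that `d φ (x) = dAlg (φ'(x))`. -/
def dAlg {n : ℕ} : (Euc n →L[ℝ] Alt n) →ₗ[ℝ] Alt n where
  toFun A := ∑ i, wedge (stdVec i) (A (stdVec i))
  map_add' A B := by simp [Finset.sum_add_distrib]
  map_smul' c A := by simp [Finset.smul_sum]

/-- `-∑ᵢ ι_{eᵢ} (A eᵢ)`, so that `δ φ (x) = deltaAlg (φ'(x))`. -/
def deltaAlg {n : ℕ} : (Euc n →L[ℝ] Alt n) →ₗ[ℝ] Alt n where
  toFun A := -∑ i, contract (stdVec i) (A (stdVec i))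
  map_add' A B := by simp [Finset.sum_add_distrib, add_comm]
  map_smul' c A := by simp [Finset.smul_sum]

/-- Smooth differential forms on `ℝⁿ` with compact support. -/
structure SmoothForm (n : ℕ) where
  toFun : Euc n → Alt n
  smooth : ContDiff ℝ ∞ toFun
  compact : HasCompactSupport toFun

namespace SmoothForm

variable {n : ℕ} (φ : SmoothForm n)

/-- The exterior differential of a smooth form. -/
def extD : Euc n → Alt n := fun x => dAlg (fderiv ℝ φ.toFun x)

/-- The codifferential of a smooth form. -/
def codiff : Euc n → Alt n := fun x => deltaAlg (fderiv ℝ φ.toFun x)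

theorem memLp_toFun (K : Set (Euc n)) : MemLp φ.toFun 2 (volume.restrict K) :=
  (φ.smooth.continuous.memLp_of_hasCompactSupport φ.compact).restrict K

theorem memLp_alg (L : (Euc n →L[ℝ] Alt n) →ₗ[ℝ] Alt n) (K : Set (Euc n)) :
    MemLp (fun x => L (fderiv ℝ φ.toFun x)) 2 (volume.restrict K) := by
  have h1 : Continuous (fun x => L (fderiv ℝ φ.toFun x)) :=
    L.continuous_of_finiteDimensional.comp (φ.smooth.continuous_fderiv (by simp))
  have h2 : HasCompactSupport (fun x => L (fderiv ℝ φ.toFun x)) :=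
    (φ.compact.fderiv (𝕜 := ℝ)).comp_left (g := L) (map_zero L)
  exact (h1.memLp_of_hasCompactSupport h2).restrict K

end SmoothForm

/-- `L²Λ(K)`: square-integrable differential forms on `K`. -/
abbrev L2Form {n : ℕ} (K : Set (Euc n)) : Type := ↥(Lp (Alt n) 2 (volume.restrict K))

namespace SmoothForm

variable {n : ℕ} (φ : SmoothForm n) (K : Set (Euc n))

/-- The restriction of a smooth form to `K`, as an element of `L²Λ(K)`. -/
def toL2 : L2Form K := (φ.memLp_toFun K).toLp φ.toFun

/-- The exterior differential of a smooth form, as an element of `L²Λ(K)`. -/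
def extDL2 : L2Form K := (φ.memLp_alg dAlg K).toLp φ.extD

/-- The codifferential of a smooth form, as an element of `L²Λ(K)`. -/
def codiffL2 : L2Form K := (φ.memLp_alg deltaAlg K).toLp φ.codiff

end SmoothForm

/-! ### Weak differential, weak codifferential, Hodge--Dirac operator -/

section WeakDerivatives

variable {n : ℕ} (K : Set (Euc n))

/-- The pairs `(w, g)` with `d w = g` in the sense of distributions on `K`:
`(g, φ)_K = (w, δ φ)_K` for all test forms `φ` with compact support in `K`. -/
def extDGraph : Submodule ℝ (L2Form K × L2Form K) where
  carrier := {x | ∀ φ : SmoothForm n, tsupport φ.toFun ⊆ K →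
    inner ℝ x.2 (φ.toL2 K) = inner ℝ x.1 (φ.codiffL2 K)}
  add_mem' {x y} hx hy φ hφ := by
    simp only [Prod.fst_add, Prod.snd_add, inner_add_left, hx φ hφ, hy φ hφ]
  zero_mem' φ _ := by simp
  smul_mem' c x hx φ hφ := by
    simp only [Prod.smul_fst, Prod.smul_snd, inner_smul_left, hx φ hφ]

/-- The pairs `(w, g)` with `δ w = g` in the sense of distributions on `K`:
`(g, φ)_K = (w, d φ)_K` for all test forms `φ` with compact support in `K`. -/
def codiffGraph : Submodule ℝ (L2Form K × L2Form K) where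
  carrier := {x | ∀ φ : SmoothForm n, tsupport φ.toFun ⊆ K →
    inner ℝ x.2 (φ.toL2 K) = inner ℝ x.1 (φ.extDL2 K)}
  add_mem' {x y} hx hy φ hφ := by
    simp only [Prod.fst_add, Prod.snd_add, inner_add_left, hx φ hφ, hy φ hφ]
  zero_mem' φ _ := by simp
  smul_mem' c x hx φ hφ := by
    simp only [Prod.smul_fst, Prod.smul_snd, inner_smul_left, hx φ hφ]

/-- The weak exterior differential; its domain is `HΛ(K)`. -/
def weakD : L2Form K →ₗ.[ℝ] L2Form K := (extDGraph K).toLinearPMap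

/-- The weak codifferential; its domain is `H*Λ(K)`. -/
def weakDelta : L2Form K →ₗ.[ℝ] L2Form K := (codiffGraph K).toLinearPMap

/-- The Hodge--Dirac operator `D = d + δ` on `HΛ(K) ∩ H*Λ(K)`. -/
def hodgeDirac : L2Form K →ₗ.[ℝ] L2Form K := weakD K + weakDelta K

/-- A form that is orthogonal to all test forms on an open set vanishes. -/
theorem eq_zero_of_forall_test {K : Set (Euc n)} (hK : IsOpen K) (g : L2Form K)
    (h : ∀ φ : SmoothForm n, tsupport φ.toFun ⊆ K → inner ℝ g (φ.toL2 K) = 0) : g = 0 := by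
  have hcoord : ∀ S : Finset (Fin n), ∀ᵐ x ∂(volume.restrict K), (g x) S = 0 := by
    intro S
    have hLp : MemLp (fun x => (g x) S) 2 (volume.restrict K) :=
      ((Lp.memLp g).continuousLinearMap_comp (EuclideanSpace.proj S : Alt n →L[ℝ] ℝ))
    have hloc : LocallyIntegrableOn (fun x => (g x) S) K volume :=
      fun x hx => (locallyIntegrableOn_of_locallyIntegrable_restrict
        (hLp.locallyIntegrable (by norm_num))) x hx
    rw [ae_restrict_iff' hK.measurableSet]
    refine hK.ae_eq_zero_of_integral_contDiff_smul_eq_zero hloc ?_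
    intro ψ hψ hψc hψK
    let φ : SmoothForm n :=
      { toFun := fun x => ψ x • EuclideanSpace.single S (1 : ℝ)
        smooth := hψ.smul contDiff_const
        compact := hψc.smul_right }
    have hsub : tsupport φ.toFun ⊆ K :=
      (closure_mono (Function.support_smul_subset_left _ _)).trans hψK
    have h0 := h φ hsub
    rw [L2.inner_def] at h0
    have hcongr : (fun x => inner ℝ (g x) ((φ.toL2 K) x)) =ᵐ[volume.restrict K]
        fun x => ψ x • (g x) S := by
      filter_upwards [(φ.memLp_toFun K).coeFn_toLp] with x hx
      have : (φ.toL2 K) x = ψ x • EuclideanSpace.single S (1 : ℝ) := hx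
      rw [this, inner_smul_right, EuclideanSpace.inner_single_right]
      simp
    rw [integral_congr_ae hcongr] at h0
    rw [← h0]
    refine (setIntegral_eq_integral_of_forall_compl_eq_zero ?_).symm
    intro x hx
    have : ψ x = 0 := image_eq_zero_of_notMem_tsupport fun hx' => hx (hψK hx')
    simp [this]
  rw [Lp.eq_zero_iff_ae_eq_zero]
  filter_upwards [ae_all_iff.2 hcoord] with x hx
  ext S
  simpa using hx S

/-- On an open set the weak differential is single valued. -/
theorem extDGraph_single_valued {K : Set (Euc n)} (hK : IsOpen K) (x : L2Form K × L2Form K)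
    (hx : x ∈ extDGraph K) (h0 : x.1 = 0) : x.2 = 0 :=
  eq_zero_of_forall_test hK _ fun φ hφ => by rw [hx φ hφ, h0, inner_zero_left]

/-- On an open set the weak codifferential is single valued. -/
theorem codiffGraph_single_valued {K : Set (Euc n)} (hK : IsOpen K) (x : L2Form K × L2Form K)
    (hx : x ∈ codiffGraph K) (h0 : x.1 = 0) : x.2 = 0 :=
  eq_zero_of_forall_test hK _ fun φ hφ => by rw [hx φ hφ, h0, inner_zero_left]

end WeakDerivatives

/-! ### Lipschitz domains, boundary forms and weak traces -/

/-- A bounded Lipschitz domain: a nonempty bounded open set that is, near each of its boundary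
points, the region below the graph of a Lipschitz function (in the direction of a unit
vector `v`). -/
structure IsLipschitzDomain {n : ℕ} (K : Set (Euc n)) : Prop where
  isOpen : IsOpen K
  nonempty : K.Nonempty
  bounded : Bornology.IsBounded K
  lipschitz_boundary : ∀ x ∈ frontier K, ∃ (v : Euc n) (γ : Euc n → ℝ) (L : NNReal) (r : ℝ),
    ‖v‖ = 1 ∧ LipschitzWith L γ ∧ 0 < r ∧
      ∀ y ∈ Metric.ball x r, (y ∈ K ↔ inner ℝ v y < γ (y - (inner ℝ v y : ℝ) • v))

section Boundary

variable {n : ℕ} (K : Set (Euc n))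

/-- Surface measure on `∂K`, i.e. `(n-1)`-dimensional Hausdorff measure, normalised to agree with
Lebesgue measure on hyperplanes. -/
def surfaceMeasure : Measure (Euc n) :=
  (Measure.euclideanHausdorffMeasure (n - 1)).restrict (frontier K)

/-- `ν` is the outward unit normal to `K` at `x`: in the limit `y → x`, `K` becomes the half space
`{y : (y - x) · ν < 0}`. -/
def IsOuterNormal (x ν : Euc n) : Prop :=
  ‖ν‖ = 1 ∧ ∀ ε > 0, ∃ r > 0, ∀ y ∈ Metric.ball x r,
    ((inner ℝ (y - x) ν : ℝ) < -ε * ‖y - x‖ → y ∈ K) ∧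
    (ε * ‖y - x‖ < (inner ℝ (y - x) ν : ℝ) → y ∉ K)

open Classical in
/-- The outward unit normal field (it exists at almost every boundary point of a Lipschitz
domain, and is set to zero elsewhere). -/
def outerNormal (x : Euc n) : Euc n :=
  if h : ∃ ν, IsOuterNormal K x ν then h.choose else 0

/-- `L²Λ(∂K)`: square-integrable differential forms on `∂K`.  Alternating forms on the tangent
space `T_x ∂K = ν(x)^⊥` are identified (isometrically) with the forms `u ∈ Alt ℝⁿ` such that
`ι_{ν(x)} u = 0`. -/
def bdryForms : Submodule ℝ (Lp (Alt n) 2 (surfaceMeasure K)) where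
  carrier := {u | ∀ᵐ x ∂(surfaceMeasure K), contract (outerNormal K x) (u x) = 0}
  add_mem' {u v} hu hv := by
    filter_upwards [hu, hv, Lp.coeFn_add u v] with x h1 h2 h3
    rw [h3, Pi.add_apply, map_add, h1, h2, add_zero]
  zero_mem' := by
    filter_upwards [Lp.coeFn_zero (Alt n) 2 (surfaceMeasure K)] with x h
    rw [h, Pi.zero_apply, map_zero]
  smul_mem' c u hu := by
    filter_upwards [hu, Lp.coeFn_smul c u] with x h1 h2
    rw [h2, Pi.smul_apply, map_smul, h1, smul_zero]

/-- `L²Λ(∂K)` as a Hilbert space. -/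
abbrev L2Bdry : Type := ↥(bdryForms K)

/-- The normal trace `φ^nor = ι_ν φ` of a smooth form. -/
def smoothNor (φ : SmoothForm n) (x : Euc n) : Alt n := contract (outerNormal K x) (φ.toFun x)

/-- The tangential trace of a smooth form (its pullback to `∂K`), `φ^tan = φ - ν ∧ ι_ν φ`. -/
def smoothTan (φ : SmoothForm n) (x : Euc n) : Alt n :=
  φ.toFun x - wedge (outerNormal K x) (contract (outerNormal K x) (φ.toFun x))

/-- `w ∈ HΛ(K)` has weak tangential trace `u ∈ L²Λ(∂K)`:
`⟨u, φ^nor⟩_∂K = (d w, φ)_K - (w, δ φ)_K` for all smooth forms `φ`.  Here `g = d w`, and `v` is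
`φ^nor` as an `L²` function on `∂K`. -/
def IsTanTrace (w : L2Form K) (u : L2Bdry K) : Prop :=
  ∃ g : L2Form K, (w, g) ∈ extDGraph K ∧
    ∀ (φ : SmoothForm n) (v : Lp (Alt n) 2 (surfaceMeasure K)),
      (⇑v =ᵐ[surfaceMeasure K] smoothNor K φ) →
      (inner ℝ (u : Lp (Alt n) 2 (surfaceMeasure K)) v : ℝ) =
        inner ℝ g (φ.toL2 K) - inner ℝ w (φ.codiffL2 K)

/-- `w ∈ H*Λ(K)` has weak normal trace `u ∈ L²Λ(∂K)`:
`⟨φ^tan, u⟩_∂K = (d φ, w)_K - (φ, δ w)_K` for all smooth forms `φ`.  Here `g = δ w`, and `v` is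
`φ^tan` as an `L²` function on `∂K`. -/
def IsNorTrace (w : L2Form K) (u : L2Bdry K) : Prop :=
  ∃ g : L2Form K, (w, g) ∈ codiffGraph K ∧
    ∀ (φ : SmoothForm n) (v : Lp (Alt n) 2 (surfaceMeasure K)),
      (⇑v =ᵐ[surfaceMeasure K] smoothTan K φ) →
      (inner ℝ v (u : Lp (Alt n) 2 (surfaceMeasure K)) : ℝ) =
        inner ℝ (φ.extDL2 K) w - inner ℝ (φ.toL2 K) g

variable {K} in
theorem IsTanTrace.add {w w' : L2Form K} {u u' : L2Bdry K} (h : IsTanTrace K w u) (h' : IsTanTrace K w' u') :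
    IsTanTrace K (w + w') (u + u') := by
  obtain ⟨g, hg, hx⟩ := h
  obtain ⟨g', hg', hy⟩ := h'
  have hadd := (extDGraph K).add_mem hg hg'
  rw [Prod.mk_add_mk] at hadd
  refine ⟨g + g', hadd, fun φ v hv => ?_⟩
  rw [Submodule.coe_add, inner_add_left, inner_add_left, inner_add_left, hx φ v hv, hy φ v hv]
  ring

theorem IsTanTrace.zero : IsTanTrace K 0 0 :=
  ⟨0, (extDGraph K).zero_mem, fun φ v _ => by
    rw [Submodule.coe_zero, inner_zero_left, inner_zero_left, inner_zero_left, sub_zero]⟩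

variable {K} in
theorem IsTanTrace.smul (c : ℝ) {w : L2Form K} {u : L2Bdry K} (h : IsTanTrace K w u) :
    IsTanTrace K (c • w) (c • u) := by
  obtain ⟨g, hg, hx⟩ := h
  refine ⟨c • g, (extDGraph K).smul_mem c hg, fun φ v hv => ?_⟩
  rw [Submodule.coe_smul, real_inner_smul_left, real_inner_smul_left, real_inner_smul_left, hx φ v hv]
  ring

variable {K} in
theorem IsNorTrace.add {w w' : L2Form K} {u u' : L2Bdry K} (h : IsNorTrace K w u) (h' : IsNorTrace K w' u') :
    IsNorTrace K (w + w') (u + u') := by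
  obtain ⟨g, hg, hx⟩ := h
  obtain ⟨g', hg', hy⟩ := h'
  have hadd := (codiffGraph K).add_mem hg hg'
  rw [Prod.mk_add_mk] at hadd
  refine ⟨g + g', hadd, fun φ v hv => ?_⟩
  rw [Submodule.coe_add, inner_add_right, inner_add_right, inner_add_right, hx φ v hv, hy φ v hv]
  ring

theorem IsNorTrace.zero : IsNorTrace K 0 0 :=
  ⟨0, (codiffGraph K).zero_mem, fun φ v _ => by
    rw [Submodule.coe_zero, inner_zero_right, inner_zero_right, inner_zero_right, sub_zero]⟩

variable {K} in
theorem IsNorTrace.smul (c : ℝ) {w : L2Form K} {u : L2Bdry K} (h : IsNorTrace K w u) :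
    IsNorTrace K (c • w) (c • u) := by
  obtain ⟨g, hg, hx⟩ := h
  refine ⟨c • g, (codiffGraph K).smul_mem c hg, fun φ v hv => ?_⟩
  rw [Submodule.coe_smul, real_inner_smul_right, real_inner_smul_right, real_inner_smul_right, hx φ v hv]
  ring

/-- The graph of the weak tangential trace. -/
def tanGraph : Submodule ℝ (L2Form K × L2Bdry K) where
  carrier := {x | IsTanTrace K x.1 x.2}
  add_mem' {_ _} hx hy := IsTanTrace.add hx hy
  zero_mem' := IsTanTrace.zero K
  smul_mem' c _ hx := IsTanTrace.smul c hx

/-- The graph of the weak normal trace. -/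
def norGraph : Submodule ℝ (L2Form K × L2Bdry K) where
  carrier := {x | IsNorTrace K x.1 x.2}
  add_mem' {_ _} hx hy := IsNorTrace.add hx hy
  zero_mem' := IsNorTrace.zero K
  smul_mem' c _ hx := IsNorTrace.smul c hx

/-- The weak tangential trace `w ↦ w^tan`; its domain consists of the `w ∈ HΛ(K)` whose tangential
trace is square integrable.  (On a Lipschitz domain the trace is unique, since the forms `φ^nor`
are dense in `L²Λ(∂K)`.) -/
def tanTrace : L2Form K →ₗ.[ℝ] L2Bdry K := (tanGraph K).toLinearPMap

/-- The weak normal trace `w ↦ w^nor`; its domain consists of the `w ∈ H*Λ(K)` whose normal trace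
is square integrable. -/
def norTrace : L2Form K →ₗ.[ℝ] L2Bdry K := (norGraph K).toLinearPMap

end Boundary

/-! ### Hybrid FEEC spaces -/

/-- A bounded Lipschitz domain `Ω ⊂ ℝⁿ` and a finite partition `𝒯_h` of it into non-overlapping
Lipschitz subdomains `K i`. -/
structure Mesh (n : ℕ) (ι : Type*) where
  Ω : Set (Euc n)
  K : ι → Set (Euc n)
  lipschitz_Ω : IsLipschitzDomain Ω
  lipschitz_K : ∀ i, IsLipschitzDomain (K i)
  subset : ∀ i, K i ⊆ Ω
  disjoint : Pairwise fun i j => Disjoint (K i) (K j)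
  cover : Ω ⊆ ⋃ i, closure (K i)

/-- The local spaces `W_h(K)`, `Ŵ_h^nor(∂K)`, `Ŵ_h^tan(∂K)` of a hybrid method. -/
structure HybridSpaces {n : ℕ} {ι : Type*} (M : Mesh n ι) where
  W : ∀ i, Submodule ℝ (L2Form (M.K i))
  Wnor : ∀ i, Submodule ℝ (L2Bdry (M.K i))
  Wtan : ∀ i, Submodule ℝ (L2Bdry (M.K i))
  /-- `W_h(K) ⊂ HΛ(K) ∩ H*Λ(K)` -/
  W_le : ∀ i, W i ≤ (weakD (M.K i)).domain ⊓ (weakDelta (M.K i)).domain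
  /-- the tangential traces are in `L²Λ(∂K)` -/
  W_tan : ∀ i, W i ≤ (tanTrace (M.K i)).domain
  /-- the normal traces are in `L²Λ(∂K)` -/
  W_nor : ∀ i, W i ≤ (norTrace (M.K i)).domain

namespace HybridSpaces

variable {n : ℕ} {ι : Type*} {M : Mesh n ι} (S : HybridSpaces M)

/-- The broken space `W_h = ∏_K W_h(K)`. -/
abbrev Wh := ∀ i, S.W i

/-- The broken normal trace space `Ŵ_h^nor`. -/
abbrev WnorH := ∀ i, S.Wnor i

/-- The broken tangential trace space `Ŵ_h^tan`. -/
abbrev WtanH := ∀ i, S.Wtan i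

/-- The function on `∂(K i)` represented by a broken tangential trace. -/
def tanFun (u : S.WtanH) (i : ι) : Euc n → Alt n :=
  ⇑((u i : L2Bdry (M.K i)) : Lp (Alt n) 2 (surfaceMeasure (M.K i)))

/-- The single-valued tangential trace space: the elements of `Ŵ_h^tan` with vanishing tangential
jump.  On an interior interface `∂(K i) ∩ ∂(K j)` the jump is the difference of the two values,
and on `∂Ω` it is the trace itself. -/
def Vo : Submodule ℝ S.WtanH where
  carrier := {u |
    (∀ i j, ∀ᵐ x ∂((surfaceMeasure (M.K i)).restrict (frontier (M.K j))),
      S.tanFun u i x = S.tanFun u j x) ∧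
    (∀ i, ∀ᵐ x ∂((surfaceMeasure (M.K i)).restrict (frontier M.Ω)), S.tanFun u i x = 0)}
  add_mem' {u v} := by
    rintro ⟨hu, hu'⟩ ⟨hv, hv'⟩
    have key : ∀ i, S.tanFun (u + v) i =ᵐ[surfaceMeasure (M.K i)]
        S.tanFun u i + S.tanFun v i := fun i => Lp.coeFn_add _ _
    have hsw : ∀ i j, (surfaceMeasure (M.K i)).restrict (frontier (M.K j)) ≤
        surfaceMeasure (M.K j) := fun i j => by
      unfold surfaceMeasure
      exact Measure.restrict_mono_measure Measure.restrict_le_self _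
    refine ⟨fun i j => ?_, fun i => ?_⟩
    · filter_upwards [hu i j, hv i j, ae_mono Measure.restrict_le_self (key i),
        ae_mono (hsw i j) (key j)] with x h1 h2 h3 h4
      rw [h3, h4, Pi.add_apply, Pi.add_apply, h1, h2]
    · filter_upwards [hu' i, hv' i, ae_mono Measure.restrict_le_self (key i)] with x h1 h2 h3
      rw [h3, Pi.add_apply, h1, h2, add_zero]
  zero_mem' := by
    have key : ∀ i, S.tanFun 0 i =ᵐ[surfaceMeasure (M.K i)] 0 := fun i => Lp.coeFn_zero _ _ _
    have hsw : ∀ i j, (surfaceMeasure (M.K i)).restrict (frontier (M.K j)) ≤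
        surfaceMeasure (M.K j) := fun i j => by
      unfold surfaceMeasure
      exact Measure.restrict_mono_measure Measure.restrict_le_self _
    refine ⟨fun i j => ?_, fun i => ?_⟩
    · filter_upwards [ae_mono Measure.restrict_le_self (key i),
        ae_mono (hsw i j) (key j)] with x h3 h4
      rw [h3, h4]
    · filter_upwards [ae_mono Measure.restrict_le_self (key i)] with x h3
      rw [h3, Pi.zero_apply]
  smul_mem' c u := by
    rintro ⟨hu, hu'⟩
    have key : ∀ i, S.tanFun (c • u) i =ᵐ[surfaceMeasure (M.K i)]
        c • S.tanFun u i := fun i => Lp.coeFn_smul _ _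
    have hsw : ∀ i j, (surfaceMeasure (M.K i)).restrict (frontier (M.K j)) ≤
        surfaceMeasure (M.K j) := fun i j => by
      unfold surfaceMeasure
      exact Measure.restrict_mono_measure Measure.restrict_le_self _
    refine ⟨fun i j => ?_, fun i => ?_⟩
    · filter_upwards [hu i j, ae_mono Measure.restrict_le_self (key i),
        ae_mono (hsw i j) (key j)] with x h1 h3 h4
      rw [h3, h4, Pi.smul_apply, Pi.smul_apply, h1]
    · filter_upwards [hu' i, ae_mono Measure.restrict_le_self (key i)] with x h1 h3
      rw [h3, Pi.smul_apply, h1, smul_zero]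

/-- An element of `W_h` as a broken `L²` form. -/
def incl : S.Wh →ₗ[ℝ] (∀ i, L2Form (M.K i)) where
  toFun w i := w i
  map_add' _ _ := rfl
  map_smul' _ _ := rfl

/-- A normal numerical trace as a broken boundary form. -/
def inclNor : S.WnorH →ₗ[ℝ] (∀ i, L2Bdry (M.K i)) where
  toFun u i := u i
  map_add' _ _ := rfl
  map_smul' _ _ := rfl

/-- A tangential numerical trace as a broken boundary form. -/
def inclTan : S.WtanH →ₗ[ℝ] (∀ i, L2Bdry (M.K i)) where
  toFun u i := u i
  map_add' _ _ := rfl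
  map_smul' _ _ := rfl

/-- The Hodge--Dirac operator, applied elementwise on `W_h`. -/
def D : S.Wh →ₗ[ℝ] (∀ i, L2Form (M.K i)) :=
  LinearMap.pi fun i =>
    ((hodgeDirac (M.K i)).toFun.comp (Submodule.inclusion (S.W_le i))).comp (LinearMap.proj i)

/-- The tangential traces of the elements of `W_h`. -/
def tan : S.Wh →ₗ[ℝ] (∀ i, L2Bdry (M.K i)) :=
  LinearMap.pi fun i =>
    ((tanTrace (M.K i)).toFun.comp (Submodule.inclusion (S.W_tan i))).comp (LinearMap.proj i)

/-- The normal traces of the elements of `W_h`. -/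
def nor : S.Wh →ₗ[ℝ] (∀ i, L2Bdry (M.K i)) :=
  LinearMap.pi fun i =>
    ((norTrace (M.K i)).toFun.comp (Submodule.inclusion (S.W_nor i))).comp (LinearMap.proj i)

end HybridSpaces

section Pairings

variable {n : ℕ} {ι : Type*} [Fintype ι] {M : Mesh n ι}

/-- The broken `L²` inner product `(·, ·)_{𝒯_h} = ∑_K (·, ·)_K`. -/
def pairT : (∀ i, L2Form (M.K i)) →ₗ[ℝ] (∀ i, L2Form (M.K i)) →ₗ[ℝ] ℝ :=
  ∑ i, (innerₗ (L2Form (M.K i))).compl₁₂ (LinearMap.proj i) (LinearMap.proj i)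

/-- The broken boundary inner product `⟨·, ·⟩_{∂𝒯_h} = ∑_K ⟨·, ·⟩_∂K`. -/
def pairB : (∀ i, L2Bdry (M.K i)) →ₗ[ℝ] (∀ i, L2Bdry (M.K i)) →ₗ[ℝ] ℝ :=
  ∑ i, (innerₗ (L2Bdry (M.K i))).compl₁₂ (LinearMap.proj i) (LinearMap.proj i)

theorem pairT_apply (u v : ∀ i, L2Form (M.K i)) : pairT u v = ∑ i, inner ℝ (u i) (v i) := by
  simp [pairT]

theorem pairB_apply (u v : ∀ i, L2Bdry (M.K i)) : pairB u v = ∑ i, inner ℝ (u i) (v i) := by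
  simp [pairB]

variable (S : HybridSpaces M)

/-- The bracket `[ẑ, w]_{∂𝒯_h} = ⟨ẑ^tan, w^nor⟩_{∂𝒯_h} - ⟨w^tan, ẑ^nor⟩_{∂𝒯_h}`, as a linear
function of `w`. -/
def bracket (zn : S.WnorH) (zt : S.WtanH) : S.Wh →ₗ[ℝ] ℝ :=
  (pairB (S.inclTan zt)).comp S.nor - (pairB.flip (S.inclNor zn)).comp S.tan

/-- The `W_h`-functional `w ↦ (z, D w)_{𝒯_h} + [ẑ, w]_{∂𝒯_h}`. -/
def spatial (z : S.Wh) (zn : S.WnorH) (zt : S.WtanH) : S.Wh →ₗ[ℝ] ℝ :=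
  (pairT (S.incl z)).comp S.D + bracket S zn zt

end Pairings

/-! ### `ℝ²`-valued forms and the semidiscrete problem

The "bold" spaces are tensor products with `ℝ²`, i.e. spaces of pairs `(q, p)`. -/

/-- `𝐉 (q, p) = (-p, q)`, on any space of pairs. -/
def bigJ {V : Type*} [AddCommGroup V] (z : V × V) : V × V := (-z.2, z.1)

section Bold

variable {n : ℕ} {ι : Type*} [Fintype ι] {M : Mesh n ι} (S : HybridSpaces M)

/-- The traces `ẑ = (ẑ^nor, ẑ^tan)` of `ℝ²`-valued forms, with the homogeneous Dirichlet condition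
imposed on `ẑ^tan`. -/
abbrev Traces := (S.WnorH × S.WnorH) × (S.Vo × S.Vo)

/-- The bold inner product `(g, w)_{𝒯_h}`, with `g` a pair of broken `L²` forms. -/
def bPair (g : (∀ i, L2Form (M.K i)) × (∀ i, L2Form (M.K i))) (w : S.Wh × S.Wh) : ℝ :=
  pairT g.1 (S.incl w.1) + pairT g.2 (S.incl w.2)

/-- The inclusion of `𝐖_h` in the bold broken `L²` forms. -/
def bIncl (z : S.Wh × S.Wh) : (∀ i, L2Form (M.K i)) × (∀ i, L2Form (M.K i)) :=
  (S.incl z.1, S.incl z.2)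

/-- `(z, 𝐃 w)_{𝒯_h} + [ẑ, w]_{∂𝒯_h}` for `ℝ²`-valued forms. -/
def bSpatial (z : S.Wh × S.Wh) (zh : Traces S) (w : S.Wh × S.Wh) : ℝ :=
  spatial S z.1 zh.1.1 zh.2.1 w.1 + spatial S z.2 zh.1.2 zh.2.2 w.2

/-- Local source terms `f_K : I × 𝐖_h(K) → 𝐋²𝚲(K)`. -/
abbrev Source (I : Set ℝ) :=
  ∀ i, I → (S.W i × S.W i) → L2Form (M.K i) × L2Form (M.K i)

variable {S} in
/-- The `q`-component `f_q(t, z)` of the source term. -/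
def Source.q {I : Set ℝ} (f : Source S I) (t : I) (z : S.Wh × S.Wh) : ∀ i, L2Form (M.K i) :=
  fun i => (f i t (z.1 i, z.2 i)).1

variable {S} in
/-- The `p`-component `f_p(t, z)` of the source term. -/
def Source.p {I : Set ℝ} (f : Source S I) (t : I) (z : S.Wh × S.Wh) : ∀ i, L2Form (M.K i) :=
  fun i => (f i t (z.1 i, z.2 i)).2

variable {S} in
/-- The source term `𝐟(t, z)`. -/
def Source.eval {I : Set ℝ} (f : Source S I) (t : I) (z : S.Wh × S.Wh) :
    (∀ i, L2Form (M.K i)) × (∀ i, L2Form (M.K i)) := (f.q t z, f.p t z)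

/-- Local flux functions: linear maps
`𝚽_K : 𝐖_h(K) × 𝐖̂_h^nor(∂K) × 𝐖̂_h^tan(∂K) → 𝐋²𝚲(∂K)`. -/
abbrev Flux := ∀ i, ((S.W i × S.W i) × (S.Wnor i × S.Wnor i) × (S.Wtan i × S.Wtan i)) →ₗ[ℝ]
  L2Bdry (M.K i) × L2Bdry (M.K i)

/-- Local flux functions for a single component: linear maps
`Φ_K : W_h(K) × Ŵ_h^nor(∂K) × Ŵ_h^tan(∂K) → L²Λ(∂K)`. -/
abbrev ScalarFlux := ∀ i, (S.W i × S.Wnor i × S.Wtan i) →ₗ[ℝ] L2Bdry (M.K i)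

variable {S} in
/-- The flux `𝚽(z, ẑ)` on all elements. -/
def Flux.eval (Φ : Flux S) (z : S.Wh × S.Wh) (zh : Traces S) :
    (∀ i, L2Bdry (M.K i)) × (∀ i, L2Bdry (M.K i)) :=
  (fun i => (Φ i ((z.1 i, z.2 i), (zh.1.1 i, zh.1.2 i), (zh.2.1.1 i, zh.2.2.1 i))).1,
   fun i => (Φ i ((z.1 i, z.2 i), (zh.1.1 i, zh.1.2 i), (zh.2.1.1 i, zh.2.2.1 i))).2)

variable {S} in
/-- A scalar flux on all elements. -/
def ScalarFlux.eval (Φ : ScalarFlux S) (z : S.Wh) (zn : S.WnorH) (zt : S.Vo) :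
    ∀ i, L2Bdry (M.K i) :=
  fun i => Φ i (z i, zn i, zt.1 i)

/-- `𝚽(z, ẑ) = (Φ_q(q, q̂), Φ_p(p, p̂))`. -/
def FluxPartitions (Φ : Flux S) (Φq Φp : ScalarFlux S) : Prop :=
  ∀ i (z : S.W i × S.W i) (zn : S.Wnor i × S.Wnor i) (zt : S.Wtan i × S.Wtan i),
    Φ i (z, zn, zt) = (Φq i (z.1, zn.1, zt.1), Φp i (z.2, zn.2, zt.2))

/-- The dynamical equation of the semidiscrete weak problem, tested with `w`:
`(𝐉 ż, w) + (z, 𝐃 w) + [ẑ, w] = (𝐟(t, z), w)`. -/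
def WeakDyn {I : Set ℝ} (f : Source S I) (t : I) (z : S.Wh × S.Wh) (zh : Traces S)
    (zdot w : S.Wh × S.Wh) : Prop :=
  bPair S (bIncl S (bigJ zdot)) w + bSpatial S z zh w = bPair S (f.eval t z) w

/-- The flux equation: `⟨𝚽(z, ẑ), ŵ^nor⟩_{∂𝒯_h} = 0` for all `ŵ^nor`. -/
def WeakNor (Φ : Flux S) (z : S.Wh × S.Wh) (zh : Traces S) : Prop :=
  ∀ wn : S.WnorH × S.WnorH,
    pairB (Φ.eval z zh).1 (S.inclNor wn.1) + pairB (Φ.eval z zh).2 (S.inclNor wn.2) = 0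

/-- The conservativity equation: `⟨ẑ^nor, ŵ^tan⟩_{∂𝒯_h} = 0` for all single-valued `ŵ^tan`
vanishing on `∂Ω`. -/
def WeakTan (zh : Traces S) : Prop :=
  ∀ wt : S.Vo × S.Vo,
    pairB (S.inclNor zh.1.1) (S.inclTan wt.1) + pairB (S.inclNor zh.1.2) (S.inclTan wt.2) = 0

variable {S} in
/-- The component `Θ_q : (t, q̃, p̃) ↦ (q, q̂^nor, q̂^tan)` of `𝚯`. -/
def thetaQ {Wt : Type*} {I : Set ℝ} (Θ : I → Wt × Wt → (S.Wh × S.Wh) × Traces S) (t : I)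
    (qt pt : Wt) : S.Wh × S.WnorH × S.Vo :=
  ((Θ t (qt, pt)).1.1, (Θ t (qt, pt)).2.1.1, (Θ t (qt, pt)).2.2.1)

variable {S} in
/-- The component `Θ_p : (t, q̃, p̃) ↦ (p, p̂^nor, p̂^tan)` of `𝚯`. -/
def thetaP {Wt : Type*} {I : Set ℝ} (Θ : I → Wt × Wt → (S.Wh × S.Wh) × Traces S) (t : I)
    (qt pt : Wt) : S.Wh × S.WnorH × S.Vo :=
  ((Θ t (qt, pt)).1.2, (Θ t (qt, pt)).2.1.2, (Θ t (qt, pt)).2.2.2)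

variable {Wt : Type*} [NormedAddCommGroup Wt] [InnerProductSpace ℝ Wt]

/-- The inner product on `𝐖̃_h = W̃_h ⊗ ℝ²`. -/
def tPair (z w : Wt × Wt) : ℝ := inner ℝ z.1 w.1 + inner ℝ z.2 w.2

/-- The reduction assumption on `𝚯 : (t, z̃) ↦ (z, ẑ)`. -/
structure ThetaAssumption {I : Set ℝ} (f : Source S I) (Φ : Flux S)
    (zmap : Wt × Wt → S.Wh × S.Wh) (Θ : I → Wt × Wt → (S.Wh × S.Wh) × Traces S) : Prop where
  /-- the map `z̃ ↦ z` does not depend on `t` -/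
  const_in_time : ∀ t zt, (Θ t zt).1 = zmap zt
  differentiable : Differentiable ℝ zmap
  /-- the map `z̃ ↦ z` is symplectic -/
  symplectic : ∀ zt w₁ w₂ : Wt × Wt,
    bPair S (bIncl S (bigJ (fderiv ℝ zmap zt w₁))) (fderiv ℝ zmap zt w₂) = tPair (bigJ w₁) w₂
  /-- if the dynamical equation holds for all `w` in the range of `∂z/∂z̃`, it holds for all
  `w ∈ 𝐖_h` -/
  extend : ∀ (t : I) (zt zdot : Wt × Wt),
    (∀ wt, WeakDyn S f t (Θ t zt).1 (Θ t zt).2 (fderiv ℝ zmap zt zdot) (fderiv ℝ zmap zt wt)) →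
    ∀ w, WeakDyn S f t (Θ t zt).1 (Θ t zt).2 (fderiv ℝ zmap zt zdot) w
  constraint_nor : ∀ t zt, WeakNor S Φ (Θ t zt).1 (Θ t zt).2
  constraint_tan : ∀ t zt, WeakTan S (Θ t zt).2

/-! ### The reduced ODE -/

/-- The Riesz representative of a linear functional on a finite-dimensional space. -/
def riesz [FiniteDimensional ℝ Wt] (l : Wt →ₗ[ℝ] ℝ) : Wt :=
  haveI := FiniteDimensional.complete ℝ Wt
  (InnerProductSpace.toDual ℝ Wt).symm (LinearMap.toContinuousLinearMap l)

theorem inner_riesz [FiniteDimensional ℝ Wt] (l : Wt →ₗ[ℝ] ℝ) (w : Wt) :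
    inner ℝ (riesz l) w = l w := by
  have := FiniteDimensional.complete ℝ Wt
  simp [riesz]

/-- The functional `w ↦ (g, w)_{𝒯_h} - (z, D w)_{𝒯_h} - [ẑ, w]_{∂𝒯_h}` on `W_h`. -/
def load (g : ∀ i, L2Form (M.K i)) (z : S.Wh) (zn : S.WnorH) (zt : S.WtanH) : S.Wh →ₗ[ℝ] ℝ :=
  (pairT g).comp S.incl - spatial S z zn zt

/-- The functional `w ↦ (𝐟(t, z), w)_{𝒯_h} - (z, 𝐃 w)_{𝒯_h} - [ẑ, w]_{∂𝒯_h}` on `𝐖_h`. -/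
def bLoad {I : Set ℝ} (f : Source S I) (t : I) (z : S.Wh × S.Wh) (zh : Traces S) :
    S.Wh × S.Wh →ₗ[ℝ] ℝ :=
  (load S (f.q t z) z.1 zh.1.1 zh.2.1).coprod (load S (f.p t z) z.2 zh.1.2 zh.2.2)

theorem bLoad_apply {I : Set ℝ} (f : Source S I) (t : I) (z : S.Wh × S.Wh) (zh : Traces S)
    (w : S.Wh × S.Wh) :
    bLoad S f t z zh w = bPair S (f.eval t z) w - bSpatial S z zh w := by
  simp [bLoad, load, bPair, bSpatial, Source.eval]
  ring

variable [FiniteDimensional ℝ Wt]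

/-- The reduced right-hand side `f̃(t, z̃) ∈ 𝐖̃_h`: the Riesz representative of
`w̃ ↦ (𝐟(t, z), w) - (z, 𝐃 w) - [ẑ, w]`, with `(z, ẑ) = 𝚯(t, z̃)` and `w = (∂z/∂z̃) w̃`. -/
def ftilde {I : Set ℝ} (f : Source S I) (zmap : Wt × Wt → S.Wh × S.Wh)
    (Θ : I → Wt × Wt → (S.Wh × S.Wh) × Traces S) (t : I) (zt : Wt × Wt) : Wt × Wt :=
  (riesz (((bLoad S f t (Θ t zt).1 (Θ t zt).2).comp (fderiv ℝ zmap zt).toLinearMap).comp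
      (LinearMap.inl ℝ Wt Wt)),
   riesz (((bLoad S f t (Θ t zt).1 (Θ t zt).2).comp (fderiv ℝ zmap zt).toLinearMap).comp
      (LinearMap.inr ℝ Wt Wt)))

/-- The defining property of the reduced right-hand side. -/
theorem tPair_ftilde {I : Set ℝ} (f : Source S I) (zmap : Wt × Wt → S.Wh × S.Wh)
    (Θ : I → Wt × Wt → (S.Wh × S.Wh) × Traces S) (t : I) (zt wt : Wt × Wt) :
    tPair (ftilde S f zmap Θ t zt) wt =
      bPair S (f.eval t (Θ t zt).1) (fderiv ℝ zmap zt wt) -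
        bSpatial S (Θ t zt).1 (Θ t zt).2 (fderiv ℝ zmap zt wt) := by
  rw [← bLoad_apply, tPair, ftilde, inner_riesz, inner_riesz]
  simp only [LinearMap.comp_apply, ← map_add]
  simp

/-- The `q`-component of the reduced right-hand side for a partitioned map `q̃ ↦ q`, `p̃ ↦ p`:
`(f̃_q(t, q̃, p̃), s̃) = (f_q(t, q, p), s) - (q, D s) - [q̂, s]` with `s = (∂q/∂q̃) s̃`. -/
def ftildeQ {I : Set ℝ} (f : Source S I) (zq : Wt → S.Wh)
    (Θ : I → Wt × Wt → (S.Wh × S.Wh) × Traces S) (t : I) (qt pt : Wt) : Wt :=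
  riesz ((load S (f.q t (Θ t (qt, pt)).1) (Θ t (qt, pt)).1.1
    (Θ t (qt, pt)).2.1.1 (Θ t (qt, pt)).2.2.1).comp (fderiv ℝ zq qt).toLinearMap)

/-- The `p`-component of the reduced right-hand side for a partitioned map `q̃ ↦ q`, `p̃ ↦ p`:
`(f̃_p(t, q̃, p̃), r̃) = (f_p(t, q, p), r) - (p, D r) - [p̂, r]` with `r = (∂p/∂p̃) r̃`. -/
def ftildeP {I : Set ℝ} (f : Source S I) (zp : Wt → S.Wh)
    (Θ : I → Wt × Wt → (S.Wh × S.Wh) × Traces S) (t : I) (qt pt : Wt) : Wt :=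
  riesz ((load S (f.p t (Θ t (qt, pt)).1) (Θ t (qt, pt)).1.2
    (Θ t (qt, pt)).2.1.2 (Θ t (qt, pt)).2.2.2).comp (fderiv ℝ zp pt).toLinearMap)

end Bold

end

end HybridFEEC

namespace HybridFEEC

/-! Write `A` for the linear map `z̃ ↦ z`, which is its own derivative at every point. Symplecticity
then reads `(𝐉 A z̃, A w̃) = (𝐉̃ z̃, w̃)`, and two facts follow.

Consistency: the velocity `𝐉̃⁻¹ f̃ = -𝐉̃ f̃` satisfies the dynamical equation for test functions in
the range of `A`, by the definition of `f̃`, and the extension hypothesis then gives it for all `w ∈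
𝐖_h`. Hence `(𝐉 A 𝐉̃⁻¹ f̃(t, z̃), w) = (𝐟, w) - (z, 𝐃 w) - [ẑ, w]` for every `w` (`symplW_reduced`).
Since `A` depends neither on time nor on the state, the left side is one fixed linear function of
`f̃`, so the identities at different stages can be combined with arbitrary coefficients.

Nondegeneracy: `(𝐉 A 𝐉̃⁻¹ v, A v) = |v|²`, so a reduced vector is determined by its weak form.

Together (`eq_add_smul_sum_iff`) they make each reduced update equivalent to its weak form
(`update_iff`). The flux and conservativity equations hold for every value of `𝚯` and add nothing to
the equivalence.

For a partitioned map, symplecticity becomes the duality `(q, p) = (q̃, p̃)` (`pairW_partition`).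
Testing with `(0, r)` or `(u, 0)` decouples the two components, so each one can be sampled at its
own times. -/

/-! ### Linear maps and weak forms of linear updates. -/

theorem fderiv_apply_of_isLinearMap {V X : Type*} [NormedAddCommGroup V] [NormedSpace ℝ V]
    [FiniteDimensional ℝ V] [NormedAddCommGroup X] [NormedSpace ℝ X] {A : V → X}
    (hA : IsLinearMap ℝ A) (v w : V) : fderiv ℝ A v w = A w := by
  -- Continuity of `A` comes from the finite dimension of its domain; the target may be
  -- infinite-dimensional.
  have h := (LinearMap.toContinuousLinearMap (hA.mk' A)).hasFDerivAt (x := v)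
  have h' : fderiv ℝ A v = LinearMap.toContinuousLinearMap (hA.mk' A) := h.fderiv
  rw [h']
  rfl

theorem isLinearMap_of_partition {V X : Type*} [AddCommGroup V] [Module ℝ V] [AddCommGroup X]
    [Module ℝ X] {A : V × V → X × X} {A₁ A₂ : V → X} (hq : IsLinearMap ℝ A₁)
    (hp : IsLinearMap ℝ A₂) (h : ∀ q p : V, A (q, p) = (A₁ q, A₂ p)) : IsLinearMap ℝ A where
  map_add x y := by
    rw [← Prod.mk.eta (p := x), ← Prod.mk.eta (p := y), Prod.mk_add_mk, h, h, h, hq.map_add,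
      hp.map_add, Prod.mk_add_mk]
  map_smul c x := by
    rw [← Prod.mk.eta (p := x), Prod.smul_mk, h, h, hq.map_smul, hp.map_smul, Prod.smul_mk]

/-- If `B (A (g k)) = F k` and `v ↦ B (A v)` is injective, then a linear update of `v₀` by the
`g k` is equivalent to its weak form. -/
theorem eq_add_smul_sum_iff {V X Y κ : Type*} [Fintype κ] [AddCommGroup V] [Module ℝ V]
    [AddCommGroup X] [Module ℝ X] [AddCommGroup Y] [Module ℝ Y] (A : V →ₗ[ℝ] X)
    (B : X →ₗ[ℝ] Y →ₗ[ℝ] ℝ) (hB : ∀ v, (∀ y, B (A v) y = 0) → v = 0)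
    {g : κ → V} {F : κ → Y → ℝ} (hg : ∀ k y, B (A (g k)) y = F k y)
    (v₁ v₀ : V) (τ : ℝ) (c : κ → ℝ) :
    v₁ = v₀ + τ • ∑ k, c k • g k ↔
      ∀ y, B (A v₁) y = B (A v₀) y + τ * ∑ k, c k * F k y := by
  have key : ∀ y, B (A (v₀ + τ • ∑ k, c k • g k)) y =
      B (A v₀) y + τ * ∑ k, c k * F k y := fun y => by
    simp [map_sum, LinearMap.sum_apply, hg]
  -- Conversely, the difference of the two sides pairs to zero with every `y`, so it vanishes by
  -- nondegeneracy.
  refine ⟨fun h y => by rw [h, key], fun h => sub_eq_zero.1 (hB _ fun y => ?_)⟩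
  rw [map_sub, map_sub, LinearMap.sub_apply, h, key, sub_self]

theorem sum_mul_sub_iff {κ : Type*} [Fintype κ] (x y τ : ℝ) (c F G : κ → ℝ) :
    x = y + τ * ∑ k, c k * (F k - G k) ↔
      x + τ * ∑ k, c k * G k = y + τ * ∑ k, c k * F k := by
  simp only [mul_sub, Finset.sum_sub_distrib]
  constructor <;> intro h <;> linarith

/-! ### The rotation `𝐉` and the symplectic form on `𝐖_h`. -/

/-- `bigJ` as a linear map. -/
def bigJₗ (V : Type*) [AddCommGroup V] [Module ℝ V] : V × V →ₗ[ℝ] V × V :=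
  (-LinearMap.snd ℝ V V).prod (LinearMap.fst ℝ V V)

theorem bigJ_neg_bigJ {V : Type*} [AddCommGroup V] (z : V × V) : bigJ (-bigJ z) = z := by
  simp [bigJ]

theorem neg_bigJ_bigJ {V : Type*} [AddCommGroup V] (z : V × V) : -bigJ (bigJ z) = z := by
  simp [bigJ]

variable {n : ℕ} {ι : Type*} [Fintype ι] {M : Mesh n ι} (S : HybridSpaces M)

/-- The `L²` inner product on `W_h` as a bilinear form. -/
noncomputable def pairW : S.Wh →ₗ[ℝ] S.Wh →ₗ[ℝ] ℝ := pairT.compl₁₂ S.incl S.incl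

/-- The bilinear form `(z, w) ↦ (𝐉 z, w)` on `𝐖_h`. -/
noncomputable def symplW : S.Wh × S.Wh →ₗ[ℝ] S.Wh × S.Wh →ₗ[ℝ] ℝ :=
  ((pairW S).compl₁₂ (LinearMap.fst ℝ _ _) (LinearMap.fst ℝ _ _) +
    (pairW S).compl₁₂ (LinearMap.snd ℝ _ _) (LinearMap.snd ℝ _ _)).comp (bigJₗ S.Wh)

theorem pairW_apply (z w : S.Wh) : pairW S z w = pairT (S.incl z) (S.incl w) := rfl

theorem symplW_apply (z w : S.Wh × S.Wh) :
    symplW S z w = bPair S (bIncl S (bigJ z)) w := rfl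

theorem symplW_eq (z w : S.Wh × S.Wh) :
    symplW S z w = -pairW S z.2 w.1 + pairW S z.1 w.2 := by
  rw [symplW_apply, bPair, bIncl, bigJ, pairW_apply, pairW_apply, map_neg, map_neg,
    LinearMap.neg_apply]

theorem pairW_comm (z w : S.Wh) : pairW S z w = pairW S w z := by
  simp only [pairW_apply, pairT_apply]
  exact Finset.sum_congr rfl fun i _ => real_inner_comm _ _

variable {S} {I : Set ℝ} {f : Source S I} {Φ : Flux S} {Wt : Type*} [NormedAddCommGroup Wt]
  [InnerProductSpace ℝ Wt]

theorem tPair_eq_zero {z : Wt × Wt} (h : tPair z z = 0) : z = 0 := by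
  have h1 := real_inner_self_nonneg (x := z.1)
  have h2 := real_inner_self_nonneg (x := z.2)
  rw [tPair] at h
  ext
  · exact inner_self_eq_zero (𝕜 := ℝ).1 (by linarith)
  · exact inner_self_eq_zero (𝕜 := ℝ).1 (by linarith)

/-! ### The constraint equations, one component at a time. -/

namespace ThetaAssumption

variable {zmap : Wt × Wt → S.Wh × S.Wh}
  {Θ : I → Wt × Wt → (S.Wh × S.Wh) × Traces S}

/-- The test pair `(un, 0)` isolates the `q`-component of the flux. The separate form is needed
because partitioned stages take `q̂` and `p̂` at different times, so the bold constraint at a single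
time does not cover the pair. -/
theorem constraint_nor_q (hΘ : ThetaAssumption S f Φ zmap Θ) {Φq Φp : ScalarFlux S}
    (hΦ : FluxPartitions S Φ Φq Φp) (t : I) (qt pt : Wt) (un : S.WnorH) :
    pairB (Φq.eval (thetaQ Θ t qt pt).1 (thetaQ Θ t qt pt).2.1 (thetaQ Θ t qt pt).2.2)
      (S.inclNor un) = 0 := by
  have h := hΘ.constraint_nor t (qt, pt) (un, 0)
  rw [map_zero, map_zero, add_zero] at h
  simp only [Flux.eval, hΦ _ _ _ _] at h
  exact h

theorem constraint_nor_p (hΘ : ThetaAssumption S f Φ zmap Θ) {Φq Φp : ScalarFlux S}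
    (hΦ : FluxPartitions S Φ Φq Φp) (t : I) (qt pt : Wt) (rn : S.WnorH) :
    pairB (Φp.eval (thetaP Θ t qt pt).1 (thetaP Θ t qt pt).2.1 (thetaP Θ t qt pt).2.2)
      (S.inclNor rn) = 0 := by
  have h := hΘ.constraint_nor t (qt, pt) (0, rn)
  rw [map_zero, map_zero, zero_add] at h
  simp only [Flux.eval, hΦ _ _ _ _] at h
  exact h

theorem constraint_tan_q (hΘ : ThetaAssumption S f Φ zmap Θ) (t : I) (qt pt : Wt) (uτ : S.Vo) :
    pairB (S.inclNor (thetaQ Θ t qt pt).2.1) (S.inclTan uτ) = 0 := by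
  simpa [thetaQ] using hΘ.constraint_tan t (qt, pt) (uτ, 0)

theorem constraint_tan_p (hΘ : ThetaAssumption S f Φ zmap Θ) (t : I) (qt pt : Wt) (rτ : S.Vo) :
    pairB (S.inclNor (thetaP Θ t qt pt).2.1) (S.inclTan rτ) = 0 := by
  simpa [thetaP] using hΘ.constraint_tan t (qt, pt) (0, rτ)

end ThetaAssumption

variable [FiniteDimensional ℝ Wt]

theorem fderiv_apply_of_isLinearMap_Wh {A : Wt → S.Wh} (hA : IsLinearMap ℝ A) (v w : Wt) :
    fderiv ℝ A v w = A w :=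
  fderiv_apply_of_isLinearMap (X := S.Wh) hA v w

theorem fderiv_apply_of_isLinearMap_bold {A : Wt × Wt → S.Wh × S.Wh} (hA : IsLinearMap ℝ A)
    (v w : Wt × Wt) : fderiv ℝ A v w = A w :=
  fderiv_apply_of_isLinearMap (V := Wt × Wt) (X := S.Wh × S.Wh) hA v w

/-! ### Reduced vector field and Runge--Kutta updates. -/

namespace ThetaAssumption

variable {zmap : Wt × Wt → S.Wh × S.Wh}
  {Θ : I → Wt × Wt → (S.Wh × S.Wh) × Traces S}

/-- The derivative of a linear map is the map itself, so infinitesimal symplecticity at one base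
point, here `0`, is a global identity. -/
theorem symplW_zmap (hΘ : ThetaAssumption S f Φ zmap Θ) (hz : IsLinearMap ℝ zmap)
    (z w : Wt × Wt) : symplW S (zmap z) (zmap w) = tPair (bigJ z) w := by
  have h := hΘ.symplectic 0 z w
  rwa [fderiv_apply_of_isLinearMap_bold hz, fderiv_apply_of_isLinearMap_bold hz] at h

/-- The reduced vector field `𝐉̃⁻¹ f̃` solves the dynamical equation for all test functions. -/
theorem symplW_reduced (hΘ : ThetaAssumption S f Φ zmap Θ) (hz : IsLinearMap ℝ zmap) (t : I)
    (zt : Wt × Wt) (w : S.Wh × S.Wh) :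
    symplW S (zmap (-bigJ (ftilde S f zmap Θ t zt))) w =
      bPair S (f.eval t (Θ t zt).1) w - bSpatial S (Θ t zt).1 (Θ t zt).2 w := by
  -- The extension hypothesis reduces the claim to test functions in the range of the derivative.
  have h := hΘ.extend t zt (-bigJ (ftilde S f zmap Θ t zt)) (fun wt => ?_) w
  · rw [WeakDyn, fderiv_apply_of_isLinearMap_bold hz, ← symplW_apply] at h
    linarith
  -- On the range, symplecticity turns the left side into `tPair (bigJ (-bigJ f̃)) wt = tPair f̃
  -- wt`, which is the defining property of `f̃`.
  · have h := tPair_ftilde S f zmap Θ t zt wt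
    rw [fderiv_apply_of_isLinearMap_bold hz] at h
    rw [WeakDyn, fderiv_apply_of_isLinearMap_bold hz, fderiv_apply_of_isLinearMap_bold hz, ← symplW_apply,
      hΘ.symplW_zmap hz, bigJ_neg_bigJ, h, sub_add_cancel]

/-- A linear update by the reduced right-hand side is equivalent to its weak form. -/
theorem update_iff (hΘ : ThetaAssumption S f Φ zmap Θ) (hz : IsLinearMap ℝ zmap)
    {κ : Type*} [Fintype κ] (T : κ → I) (Zt : κ → Wt × Wt) (z₁ z₀ : Wt × Wt) (τ : ℝ)
    (c : κ → ℝ) :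
    bigJ z₁ = bigJ z₀ + τ • ∑ k, c k • ftilde S f zmap Θ (T k) (Zt k) ↔
      ∀ w : S.Wh × S.Wh,
        bPair S (bIncl S (bigJ (zmap z₁))) w +
            τ * ∑ k, c k * bSpatial S (Θ (T k) (Zt k)).1 (Θ (T k) (Zt k)).2 w =
          bPair S (bIncl S (bigJ (zmap z₀))) w +
            τ * ∑ k, c k * bPair S (f.eval (T k) (Θ (T k) (Zt k)).1) w := by
  -- The unknowns of the update are `bigJ z₁` and `bigJ z₀`, so `zmap` is preceded by `-bigJ`, the
  -- inverse of `bigJ`.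
  have hA : ∀ z : Wt × Wt, ((hz.mk' zmap).comp (-bigJₗ Wt)) z = zmap (-bigJ z) := fun _ => rfl
  refine (eq_add_smul_sum_iff (V := Wt × Wt) ((hz.mk' zmap).comp (-bigJₗ Wt)) (symplW S)
    (F := fun k w => bPair S (f.eval (T k) (Θ (T k) (Zt k)).1) w -
      bSpatial S (Θ (T k) (Zt k)).1 (Θ (T k) (Zt k)).2 w)
    (fun v hv => ?_) (fun k w => ?_) (bigJ z₁) (bigJ z₀) τ c).trans
    (forall_congr' fun w => ?_)
  -- Testing with `zmap v` produces `tPair v v`.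
  · have h := hv (zmap v)
    rw [hA, hΘ.symplW_zmap hz, bigJ_neg_bigJ] at h
    exact tPair_eq_zero h
  · rw [hA, hΘ.symplW_reduced hz]
  · rw [sum_mul_sub_iff, hA, hA, neg_bigJ_bigJ, neg_bigJ_bigJ, symplW_apply, symplW_apply]

/-! ### Partitioned maps and partitioned updates. -/

section Partitioned

variable {zq zp : Wt → S.Wh}

/-- Symplecticity evaluated on `(q, 0)` and `(0, p)`: of the two terms of the form, only the pairing
of `zq q` with `zp p` survives. Thus each of `zq`, `zp` is injective, with the range of the other as
a sufficient set of test functions. -/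
theorem pairW_partition (hΘ : ThetaAssumption S f Φ zmap Θ) (hq : IsLinearMap ℝ zq)
    (hp : IsLinearMap ℝ zp) (h : ∀ qt pt : Wt, zmap (qt, pt) = (zq qt, zp pt)) (q p : Wt) :
    pairW S (zq q) (zp p) = inner ℝ q p := by
  have h' := hΘ.symplW_zmap (isLinearMap_of_partition hq hp h) (q, 0) (0, p)
  rw [symplW_eq, h, h] at h'
  simpa [hq.map_zero, hp.map_zero, tPair, bigJ] using h'

/-- The derivative of the partitioned map is block diagonal, so the pullback of the load along each
factor involves only that factor's map. -/
theorem ftilde_partition (hq : IsLinearMap ℝ zq) (hp : IsLinearMap ℝ zp)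
    (h : ∀ qt pt : Wt, zmap (qt, pt) = (zq qt, zp pt)) (t : I) (qt pt : Wt) :
    ftilde S f zmap Θ t (qt, pt) = (ftildeQ S f zq Θ t qt pt, ftildeP S f zp Θ t qt pt) := by
  have hz := isLinearMap_of_partition hq hp h
  rw [ftilde, ftildeQ, ftildeP]
  congr 2
  · ext w
    simp [fderiv_apply_of_isLinearMap_bold hz, fderiv_apply_of_isLinearMap_Wh hq, h, hp.map_zero, bLoad]
  · ext w
    simp [fderiv_apply_of_isLinearMap_bold hz, fderiv_apply_of_isLinearMap_Wh hp, h, hq.map_zero, bLoad]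

/-- The extension hypothesis concerns pairs only, so it is used for the pair `(u, r)`, with velocity
`-𝐉̃ f̃ = (f̃_p, -f̃_q)`. Setting `u = 0` or `r = 0` afterwards gives the two scalar identities,
each usable at its own time. -/
theorem symplW_reduced_partition (hΘ : ThetaAssumption S f Φ zmap Θ) (hq : IsLinearMap ℝ zq)
    (hp : IsLinearMap ℝ zp) (h : ∀ qt pt : Wt, zmap (qt, pt) = (zq qt, zp pt)) (t : I)
    (qt pt : Wt) (u r : S.Wh) :
    -pairW S (zp (-ftildeQ S f zq Θ t qt pt)) u + pairW S (zq (ftildeP S f zp Θ t qt pt)) r =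
      (pairT (f.q t (zq qt, zp pt)) (S.incl u) -
        spatial S (thetaQ Θ t qt pt).1 (thetaQ Θ t qt pt).2.1 (thetaQ Θ t qt pt).2.2 u) +
      (pairT (f.p t (zq qt, zp pt)) (S.incl r) -
        spatial S (thetaP Θ t qt pt).1 (thetaP Θ t qt pt).2.1 (thetaP Θ t qt pt).2.2 r) := by
  have h' := hΘ.symplW_reduced (isLinearMap_of_partition hq hp h) t (qt, pt) (u, r)
  have hJ : -bigJ (ftilde S f zmap Θ t (qt, pt)) =
      (ftildeP S f zp Θ t qt pt, -ftildeQ S f zq Θ t qt pt) := by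
    rw [ftilde_partition hq hp h]
    simp [bigJ]
  rw [hJ, h, symplW_eq, bPair, bSpatial] at h'
  simp only [Source.eval] at h'
  rw [show f.q t (zq qt, zp pt) = f.q t (Θ t (qt, pt)).1 by rw [hΘ.const_in_time, h],
    -- The source sees only `z`, which `𝚯` produces independently of time.
    show f.p t (zq qt, zp pt) = f.p t (Θ t (qt, pt)).1 by rw [hΘ.const_in_time, h]]
  simp only [thetaQ, thetaP]
  linarith

theorem update_q_iff (hΘ : ThetaAssumption S f Φ zmap Θ) (hq : IsLinearMap ℝ zq)
    (hp : IsLinearMap ℝ zp) (h : ∀ qt pt : Wt, zmap (qt, pt) = (zq qt, zp pt))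
    {κ : Type*} [Fintype κ] (T : κ → I) (Qt Pt : κ → Wt) (q₁ q₀ : Wt) (τ : ℝ) (c : κ → ℝ) :
    q₁ = q₀ + τ • ∑ k, c k • ftildeP S f zp Θ (T k) (Qt k) (Pt k) ↔
      ∀ r : S.Wh,
        pairT (S.incl (zq q₁)) (S.incl r) +
            τ * ∑ k, c k * spatial S (thetaP Θ (T k) (Qt k) (Pt k)).1
              (thetaP Θ (T k) (Qt k) (Pt k)).2.1 (thetaP Θ (T k) (Qt k) (Pt k)).2.2 r =
          pairT (S.incl (zq q₀)) (S.incl r) +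
            τ * ∑ k, c k * pairT (f.p (T k) (zq (Qt k), zp (Pt k))) (S.incl r) := by
  rw [eq_add_smul_sum_iff (hq.mk' zq) (pairW S) (fun v hv => ?_) (fun k r => ?_)]
  · exact forall_congr' fun r => sum_mul_sub_iff _ _ _ _ _ _
  -- The dual map supplies the test function: `(zq v, zp v) = |v|²`.
  · have h' := hv (zp v)
    rw [IsLinearMap.mk'_apply, hΘ.pairW_partition hq hp h] at h'
    exact inner_self_eq_zero (𝕜 := ℝ).1 h'
  · simpa using hΘ.symplW_reduced_partition hq hp h (T k) (Qt k) (Pt k) 0 r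

theorem update_p_iff (hΘ : ThetaAssumption S f Φ zmap Θ) (hq : IsLinearMap ℝ zq)
    (hp : IsLinearMap ℝ zp) (h : ∀ qt pt : Wt, zmap (qt, pt) = (zq qt, zp pt))
    {κ : Type*} [Fintype κ] (T : κ → I) (Qt Pt : κ → Wt) (p₁ p₀ : Wt) (τ : ℝ) (c : κ → ℝ) :
    p₁ = p₀ + τ • ∑ k, c k • -ftildeQ S f zq Θ (T k) (Qt k) (Pt k) ↔
      ∀ u : S.Wh,
        -pairT (S.incl (zp p₁)) (S.incl u) +
            τ * ∑ k, c k * spatial S (thetaQ Θ (T k) (Qt k) (Pt k)).1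
              (thetaQ Θ (T k) (Qt k) (Pt k)).2.1 (thetaQ Θ (T k) (Qt k) (Pt k)).2.2 u =
          -pairT (S.incl (zp p₀)) (S.incl u) +
            τ * ∑ k, c k * pairT (f.q (T k) (zq (Qt k), zp (Pt k))) (S.incl u) := by
  -- The form `-pairW` carries the sign of `p` in `𝐉 (q, p) = (-p, q)`; applied to the increments
  -- `-f̃_q`, it yields the load with a positive sign.
  rw [eq_add_smul_sum_iff (hp.mk' zp) (-pairW S) (fun v hv => ?_) (fun k u => ?_)]
  · exact forall_congr' fun u => sum_mul_sub_iff _ _ _ _ _ _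
  · have h' := hv (zq v)
    rw [IsLinearMap.mk'_apply, LinearMap.neg_apply, LinearMap.neg_apply, neg_eq_zero,
      pairW_comm, hΘ.pairW_partition hq hp h] at h'
    exact inner_self_eq_zero (𝕜 := ℝ).1 h'
  · simpa using hΘ.symplW_reduced_partition hq hp h (T k) (Qt k) (Pt k) u 0

end Partitioned

end ThetaAssumption

end HybridFEEC

/-! ### The equivalence theorem. -/

set_option maxHeartbeats 1600000

open HybridFEEC in
theorem mainTheorem11 {n : ℕ} {ι : Type*} [Fintype ι] (M : Mesh n ι) (S : HybridSpaces M)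
    (I : Set ℝ) (f : Source S I) (Φ : Flux S)
    {Wt : Type*} [NormedAddCommGroup Wt] [InnerProductSpace ℝ Wt] [FiniteDimensional ℝ Wt]
    (zmap : Wt × Wt → S.Wh × S.Wh) (Θ : I → Wt × Wt → (S.Wh × S.Wh) × Traces S)
    (hΘ : ThetaAssumption S f Φ zmap Θ) (t₀ Δt : ℝ) (s : ℕ) :
    -- Runge--Kutta methods
    (IsLinearMap ℝ zmap →
      ∀ (a : Fin s → Fin s → ℝ) (b c : Fin s → ℝ) (T : Fin s → I)
        (_ : ∀ i, (T i : ℝ) = t₀ + c i * Δt)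
        (Zt : Fin s → Wt × Wt) (zt₀ zt₁ : Wt × Wt)
        (Z : Fin s → S.Wh × S.Wh) (Zh : Fin s → Traces S)
        (_ : ∀ i, (Z i, Zh i) = Θ (T i) (Zt i)),
        ((∀ i, bigJ (Zt i) = bigJ zt₀ + Δt • ∑ j, a i j • ftilde S f zmap Θ (T j) (Zt j)) ↔
          ∀ i,
            (∀ w : S.Wh × S.Wh,
              bPair S (bIncl S (bigJ (Z i))) w + Δt * ∑ j, a i j * bSpatial S (Z j) (Zh j) w =
                bPair S (bIncl S (bigJ (zmap zt₀))) w +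
                  Δt * ∑ j, a i j * bPair S (f.eval (T j) (Z j)) w) ∧
            WeakNor S Φ (Z i) (Zh i) ∧
            WeakTan S (Zh i)) ∧
        (bigJ zt₁ = bigJ zt₀ + Δt • ∑ i, b i • ftilde S f zmap Θ (T i) (Zt i) ↔
          ∀ w : S.Wh × S.Wh,
            bPair S (bIncl S (bigJ (zmap zt₁))) w + Δt * ∑ i, b i * bSpatial S (Z i) (Zh i) w =
              bPair S (bIncl S (bigJ (zmap zt₀))) w +
                Δt * ∑ i, b i * bPair S (f.eval (T i) (Z i)) w)) ∧
    -- Partitioned Runge--Kutta methods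
    (∀ (zq zp : Wt → S.Wh) (Φq Φp : ScalarFlux S),
      IsLinearMap ℝ zq → IsLinearMap ℝ zp →
      (∀ qt pt : Wt, zmap (qt, pt) = (zq qt, zp pt)) →
      FluxPartitions S Φ Φq Φp →
      ∀ (a a' : Fin s → Fin s → ℝ) (b b' c c' : Fin s → ℝ) (T T' : Fin s → I)
        (_ : ∀ i, (T i : ℝ) = t₀ + c i * Δt) (_ : ∀ i, (T' i : ℝ) = t₀ + c' i * Δt)
        (Qt Pt : Fin s → Wt) (qt₀ pt₀ qt₁ pt₁ : Wt)
        (Q P : Fin s → S.Wh) (Qn Pn : Fin s → S.WnorH) (Qτ Pτ : Fin s → S.Vo)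
        (_ : ∀ i, (Q i, Qn i, Qτ i) = thetaQ Θ (T' i) (Qt i) (Pt i))
        (_ : ∀ i, (P i, Pn i, Pτ i) = thetaP Θ (T i) (Qt i) (Pt i)),
        ((∀ i,
            Qt i = qt₀ + Δt • ∑ j, a i j • ftildeP S f zp Θ (T j) (Qt j) (Pt j) ∧
            Pt i = pt₀ + Δt • ∑ j, a' i j • -ftildeQ S f zq Θ (T' j) (Qt j) (Pt j)) ↔
          ∀ i,
            (∀ r : S.Wh,
              pairT (S.incl (Q i)) (S.incl r) +
                  Δt * ∑ j, a i j * spatial S (P j) (Pn j) (Pτ j) r =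
                pairT (S.incl (zq qt₀)) (S.incl r) +
                  Δt * ∑ j, a i j * pairT (f.p (T j) (Q j, P j)) (S.incl r)) ∧
            (∀ u : S.Wh,
              -pairT (S.incl (P i)) (S.incl u) +
                  Δt * ∑ j, a' i j * spatial S (Q j) (Qn j) (Qτ j) u =
                -pairT (S.incl (zp pt₀)) (S.incl u) +
                  Δt * ∑ j, a' i j * pairT (f.q (T' j) (Q j, P j)) (S.incl u)) ∧
            (∀ un : S.WnorH, pairB (Φq.eval (Q i) (Qn i) (Qτ i)) (S.inclNor un) = 0) ∧
            (∀ rn : S.WnorH, pairB (Φp.eval (P i) (Pn i) (Pτ i)) (S.inclNor rn) = 0) ∧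
            (∀ uτ : S.Vo, pairB (S.inclNor (Qn i)) (S.inclTan uτ) = 0) ∧
            (∀ rτ : S.Vo, pairB (S.inclNor (Pn i)) (S.inclTan rτ) = 0)) ∧
        ((qt₁ = qt₀ + Δt • ∑ i, b i • ftildeP S f zp Θ (T i) (Qt i) (Pt i) ∧
            pt₁ = pt₀ + Δt • ∑ i, b' i • -ftildeQ S f zq Θ (T' i) (Qt i) (Pt i)) ↔
          (∀ r : S.Wh,
            pairT (S.incl (zq qt₁)) (S.incl r) +
                Δt * ∑ i, b i * spatial S (P i) (Pn i) (Pτ i) r =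
              pairT (S.incl (zq qt₀)) (S.incl r) +
                Δt * ∑ i, b i * pairT (f.p (T i) (Q i, P i)) (S.incl r)) ∧
          (∀ u : S.Wh,
            -pairT (S.incl (zp pt₁)) (S.incl u) +
                Δt * ∑ i, b' i * spatial S (Q i) (Qn i) (Qτ i) u =
              -pairT (S.incl (zp pt₀)) (S.incl u) +
                Δt * ∑ i, b' i * pairT (f.q (T' i) (Q i, P i)) (S.incl u)))) := by
  refine ⟨fun hz a b c T _ Zt zt₀ zt₁ Z Zh hZ => ?_,
    fun zq zp Φq Φp hq hp h hΦ a a' b b' c c' T T' _ _ Qt Pt qt₀ pt₀ qt₁ pt₁ Q P Qn Pn Qτ Pτ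
      hQ hP => ?_⟩
  · obtain rfl : Z = fun i => (Θ (T i) (Zt i)).1 := funext fun i => congrArg Prod.fst (hZ i)
    obtain rfl : Zh = fun i => (Θ (T i) (Zt i)).2 := funext fun i => congrArg Prod.snd (hZ i)
    refine ⟨forall_congr' fun i => ?_, hΘ.update_iff hz T Zt zt₁ zt₀ Δt b⟩
    rw [hΘ.update_iff hz T Zt (Zt i) zt₀ Δt (a i), ← hΘ.const_in_time (T i) (Zt i)]
    -- Both constraints hold for every value of `𝚯`, so they can be adjoined freely.
    exact (and_iff_left ⟨hΘ.constraint_nor _ _, hΘ.constraint_tan _ _⟩).symm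
  · obtain rfl : Qn = fun i => (thetaQ Θ (T' i) (Qt i) (Pt i)).2.1 :=
      funext fun i => congrArg (fun x => x.2.1) (hQ i)
    obtain rfl : Qτ = fun i => (thetaQ Θ (T' i) (Qt i) (Pt i)).2.2 :=
      funext fun i => congrArg (fun x => x.2.2) (hQ i)
    obtain rfl : Pn = fun i => (thetaP Θ (T i) (Qt i) (Pt i)).2.1 :=
      funext fun i => congrArg (fun x => x.2.1) (hP i)
    obtain rfl : Pτ = fun i => (thetaP Θ (T i) (Qt i) (Pt i)).2.2 :=
      funext fun i => congrArg (fun x => x.2.2) (hP i)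
    -- `Q i` is taken from `𝚯` at time `T' i`, but `f̃_p` uses the value of `q` at `T i`; likewise
    -- for `P i` with the times exchanged. The values agree because `z̃ ↦ z` is independent of time.
    -- The traces may depend on time, but `f̃_p` involves only `p̂` and `f̃_q` only `q̂`, each at
    -- the matching time.
    have hθq : ∀ i, (thetaQ Θ (T' i) (Qt i) (Pt i)).1 = zq (Qt i) := fun i => by
      rw [thetaQ, hΘ.const_in_time, h]
    have hθp : ∀ i, (thetaP Θ (T i) (Qt i) (Pt i)).1 = zp (Pt i) := fun i => by
      rw [thetaP, hΘ.const_in_time, h]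
    have hQz : Q = fun i => zq (Qt i) :=
      funext fun i => (congrArg Prod.fst (hQ i)).trans (hθq i)
    have hPz : P = fun i => zp (Pt i) :=
      funext fun i => (congrArg Prod.fst (hP i)).trans (hθp i)
    clear hQ hP
    subst hQz
    subst hPz
    have hq_iff := hΘ.update_q_iff hq hp h T Qt Pt
    have hp_iff := hΘ.update_p_iff hq hp h T' Qt Pt
    simp only [hθp] at hq_iff
    simp only [hθq] at hp_iff
    constructor
    · refine forall_congr' fun i => ?_
      have hnq := hΘ.constraint_nor_q hΦ (T' i) (Qt i) (Pt i)
      have hnp := hΘ.constraint_nor_p hΦ (T i) (Qt i) (Pt i)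
      rw [hθq] at hnq
      rw [hθp] at hnp
      rw [hq_iff, hp_iff]
      refine and_congr_right fun _ => ?_
      exact (and_iff_left ⟨hnq, hnp, hΘ.constraint_tan_q (T' i) (Qt i) (Pt i),
        hΘ.constraint_tan_p (T i) (Qt i) (Pt i)⟩).symm
    · rw [hq_iff, hp_iff]
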